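/- Let $\Delta$ be a finite set of derivation symbols. All rings are commutative with identity; a differential ring is a ring $R$ on which each symbol in $\Delta$ acts as a derivation $R\to R$, these derivations commuting pairwise. A Ritt algebra is a differential ring that is an algebra over $\mathbb{Q}$. For a differential ring $R$ let $\operatorname{Spec}^{\Delta} R$ be the set of prime differential ideals of $R$ (prime ideals stable under all derivations in $\Delta$), with the Zariski topology, i.e. the topology induced from $\operatorname{Spec} R$. A subset of a topological space is called constructible if it has the form $(U_1\cap V_1)\cup\dots\cup(U_n\cap V_n)$ with all $U_i$ open and all $V_i$ closed. Let $A$ be a Ritt algebra such that $\operatorname{Spec}^{\Delta} A$ is a noetherian topological space, and let $f\colon A\to B$ be a homomorphism of differential rings (that is, commuting with the derivations in $\Delta$) such that $B$ is differentially finitely generated over $A$: there is a finite subset $S\subseteq B$ such that the only $A$-subalgebra of $B$ that contains $S$ and is stable under all derivations in $\Delta$ is $B$ itself. Let $f^*_{\Delta}\colon \operatorname{Spec}^{\Delta} B\to \operatorname{Spec}^{\Delta} A$ be the map $\mathfrak{q}\mapsto f^{-1}(\mathfrak{q})$. Then for every constructible subset $E\subseteq \operatorname{Spec}^{\Delta}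 B$ the image $f^*_{\Delta}(E)$ is a constructible subset of $\operatorname{Spec}^{\Delta} A$. -/

import Mathlib

/-- A differential ring: a commutative ring `R` on which every symbol `d : Δ` acts as a derivation,
the derivations commuting pairwise. -/
class DiffRing (Δ : Type*) (R : Type*) [CommRing R] where
  /-- The derivation by which the symbol `d` acts. -/
  der : Δ → Derivation ℤ R R
  der_comm : ∀ (d e : Δ) (x : R), der d (der e x) = der e (der d x)

/-- `B` is a differential algebra over the differential ring `A`: the structure homomorphism
`A → B` is a homomorphism of differential rings. -/
class IsDiffAlgebra (Δ : Type*) (A B : Type*) [CommRing A] [CommRing B] [DiffRing Δ A]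
    [DiffRing Δ B] [Algebra A B] : Prop where
  der_algebraMap : ∀ (d : Δ) (a : A),
    DiffRing.der d (algebraMap A B a) = algebraMap A B (DiffRing.der d a)

/-- The differential `A`-subalgebra of `B` generated by `S`: the smallest `A`-subalgebra that
contains `S` and is stable under all the derivations. -/
def diffAdjoin (Δ : Type*) (A : Type*) {B : Type*} [CommRing A] [CommRing B] [DiffRing Δ B]
    [Algebra A B] (S : Set B) : Subalgebra A B :=
  sInf {T : Subalgebra A B | S ⊆ T ∧ ∀ (d : Δ), ∀ x ∈ T, DiffRing.der d x ∈ T}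

/-- `B` is differentially finitely generated over `A`. -/
def IsDiffFG (Δ : Type*) (A B : Type*) [CommRing A] [CommRing B] [DiffRing Δ B]
    [Algebra A B] : Prop :=
  ∃ S : Finset B, diffAdjoin Δ A (S : Set B) = ⊤

/-- A differential ideal: an ideal stable under all the derivations. -/
def IsDiffIdeal (Δ : Type*) {R : Type*} [CommRing R] [DiffRing Δ R] (I : Ideal R) : Prop :=
  ∀ (d : Δ), ∀ x ∈ I, DiffRing.der d x ∈ I

/-- The differential spectrum: the set of prime differential ideals of `R`, with the Zariski
topology (the topology induced from the prime spectrum). -/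
abbrev DiffSpec (Δ : Type*) (R : Type*) [CommRing R] [DiffRing Δ R] : Type _ :=
  {p : PrimeSpectrum R // IsDiffIdeal Δ p.asIdeal}

/-- The map `Spec^Δ B → Spec^Δ A`, `𝔮 ↦ f⁻¹(𝔮)`, induced by the structure homomorphism
`f : A → B` of a differential algebra. -/
def diffSpecComap (Δ : Type*) (A B : Type*) [CommRing A] [CommRing B] [DiffRing Δ A]
    [DiffRing Δ B] [Algebra A B] [IsDiffAlgebra Δ A B] (q : DiffSpec Δ B) : DiffSpec Δ A :=
  ⟨PrimeSpectrum.comap (algebraMap A B) q.1, fun d x hx => by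
    have h := q.2 d _ hx
    rw [IsDiffAlgebra.der_algebraMap] at h
    exact h⟩

/-- A subset of a topological space is constructible if it is of the form
`(U₁ ∩ V₁) ∪ … ∪ (Uₙ ∩ Vₙ)` with all `Uᵢ` open and all `Vᵢ` closed. -/
def IsConstr {X : Type*} [TopologicalSpace X] (E : Set X) : Prop :=
  ∃ (n : ℕ) (U V : Fin n → Set X),
    (∀ i, IsOpen (U i)) ∧ (∀ i, IsClosed (V i)) ∧ E = ⋃ i, U i ∩ V i

-- The argument is Chevalley's, by noetherian induction on closed subsets of `Spec^Δ B`. For a prime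
-- differential ideal `q`, either `E` misses a neighbourhood of the generic point of `V(q)`, and one
-- passes to a smaller closed set, or `E` contains the part of `V(q)` where some `b ∉ q` does not
-- vanish. In the second case one needs `a ∈ A` nonzero modulo `q` such that every prime
-- differential `p ⊇ q ∩ A` with `a ∉ p` is the contraction of a prime differential ideal containing
-- `q` but not `b` (`exists_forall_exists_comap_eq`).
--
-- As `B` need not be a finitely generated algebra, this rests on Ritt's reduction. The derivatives
-- of the generators are well-ordered by a ranking; modulo `q`, those algebraic over the lower ones
-- are the leaders. Differentiating a minimal relation gives an equation linear in the new
-- derivative, whose coefficient (the separant) is not in `q`. So leaders are stable under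
-- derivation, and by Dickson's lemma finitely many of them yield all others, with finitely many
-- denominators (`exists_finset_relations`). Hence `B/q` lies in a finitely generated algebraic
-- extension of a polynomial ring over the image of `A`, through which ordinary primes lift. Over
-- `ℚ` the largest differential ideal inside a lifted prime is prime, and it still contracts to `p`.
--
-- The same reduction gives the Ritt–Raudenbush theorem (`RankedGenerators.hasFiniteBasis`): closed
-- subsets of `Spec^Δ B` are cut out by finitely many elements, which makes the induction
-- legitimate.

universe u

/-! ### Lifting ordinary primes -/

/-- A common denominator `y` of the generators makes `S` integral over `R` after inverting `y`;
lying over then applies to primes avoiding `y`. -/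
theorem Algebra.exists_forall_prime_exists_prime_over_of_isAlgebraic {R S : Type*} [CommRing R]
    [IsDomain R] [CommRing S] [IsDomain S] [Algebra R S] [FaithfulSMul R S]
    [Algebra.IsAlgebraic R S] (G : Finset S) (hG : Algebra.adjoin R (G : Set S) = ⊤) :
    ∃ g : R, g ≠ 0 ∧ ∀ p : Ideal R, p.IsPrime → g ∉ p →
      ∃ q : Ideal S, q.IsPrime ∧ q.comap (algebraMap R S) = p := by
  obtain ⟨y, hy0, hy⟩ := Algebra.IsAlgebraic.exists_integral_multiples R G
  refine ⟨y, hy0, fun p hp hyp => ?_⟩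
  let T := integralClosure R S
  have hT : ∀ x : S, ∃ n : ℕ, (algebraMap R S y) ^ n * x ∈ T := by
    intro x
    have hx : x ∈ Algebra.adjoin R (G : Set S) := hG ▸ Algebra.mem_top
    have hyT : algebraMap R S y ∈ T := T.algebraMap_mem y
    induction hx using Algebra.adjoin_induction with
    | mem x hx => exact ⟨1, by rw [pow_one, ← Algebra.smul_def]; exact hy x hx⟩
    | algebraMap a => exact ⟨0, by simp⟩
    | add u v _ _ hu hv =>
      obtain ⟨n, hn⟩ := hu
      obtain ⟨m, hm⟩ := hv
      refine ⟨n + m, ?_⟩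
      have := T.add_mem (T.mul_mem (pow_mem hyT m) hn) (T.mul_mem (pow_mem hyT n) hm)
      convert this using 1
      ring
    | mul u v _ _ hu hv =>
      obtain ⟨n, hn⟩ := hu
      obtain ⟨m, hm⟩ := hv
      refine ⟨n + m, ?_⟩
      convert T.mul_mem hn hm using 1
      ring
  obtain ⟨⟨Q, hQ⟩, hQp⟩ := Algebra.IsIntegral.comap_surjective R T ⟨p, hp⟩
  replace hQp : Q.comap (algebraMap R T) = p := congrArg PrimeSpectrum.asIdeal hQp
  have hmem : ∀ a : R, algebraMap R T a ∈ Q ↔ a ∈ p := fun a => by rw [← hQp]; rfl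
  let Y : T := algebraMap R T y
  have hY : ∀ n, Y ^ n ∉ Q := fun n hn => hyp ((hmem y).1 (hQ.mem_of_pow_mem n hn))
  -- The contraction to `S` of the extension of `Q` to the localization at `y`, written without
  -- localizing.
  let q : Ideal S :=
    { carrier := {x | ∃ n : ℕ, ∃ t ∈ Q, (t : S) = (algebraMap R S y) ^ n * x}
      zero_mem' := ⟨0, 0, Q.zero_mem, by simp⟩
      add_mem' := by
        rintro u v ⟨n, t, ht, htn⟩ ⟨m, s, hs, hsm⟩
        refine ⟨n + m, Y ^ m * t + Y ^ n * s,
          Q.add_mem (Q.mul_mem_left _ ht) (Q.mul_mem_left _ hs), ?_⟩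
        have : (Y : S) = algebraMap R S y := rfl
        push_cast
        rw [htn, hsm, this]
        ring
      smul_mem' := by
        rintro c x ⟨n, t, ht, htn⟩
        obtain ⟨m, hm⟩ := hT c
        refine ⟨m + n, ⟨_, hm⟩ * t, Q.mul_mem_left _ ht, ?_⟩
        push_cast
        rw [htn, smul_eq_mul]
        ring }
  have hq : ∀ (x : S) (n : ℕ) (t : T), (t : S) = (algebraMap R S y) ^ n * x → x ∈ q → t ∈ Q := by
    rintro x n t ht ⟨m, s, hs, hsm⟩
    have : Y ^ m * t = Y ^ n * s := by
      apply Subtype.ext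
      have : (Y : S) = algebraMap R S y := rfl
      push_cast
      rw [ht, hsm, this]
      ring
    exact (hQ.mem_or_mem (this ▸ Q.mul_mem_left _ hs)).resolve_left (hY m)
  have hcomap : ∀ a : R, algebraMap R S a ∈ q ↔ a ∈ p := fun a =>
    ⟨fun h => (hmem a).1 (hq _ 0 (algebraMap R T a) (by rw [pow_zero, one_mul]; rfl) h),
      fun h => ⟨0, algebraMap R T a, (hmem a).2 h, by rw [pow_zero, one_mul]; rfl⟩⟩
  refine ⟨q, Ideal.isPrime_iff.2 ⟨fun htop => ?_, ?_⟩, Ideal.ext hcomap⟩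
  · apply hp.one_notMem
    rw [← hcomap, htop]
    trivial
  · intro u v huv
    obtain ⟨n, hn⟩ := hT u
    obtain ⟨m, hm⟩ := hT v
    have := hq _ (n + m) (⟨_, hn⟩ * ⟨_, hm⟩) (by push_cast; ring) huv
    rcases hQ.mem_or_mem this with h | h
    · exact Or.inl ⟨n, _, h, rfl⟩
    · exact Or.inr ⟨m, _, h, rfl⟩

/-- Take for `g` a nonzero coefficient of the polynomial `f`: if `g ∉ p`, then `f` survives in the
polynomial ring over the domain `R ⧸ p`. -/
theorem AlgebraicIndependent.exists_forall_prime_exists_prime_over {R S σ : Type*} [CommRing R]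
    [CommRing S] [Algebra R S] {x : σ → S} (hx : AlgebraicIndependent R x)
    {f : Algebra.adjoin R (Set.range x)} (hf : f ≠ 0) :
    ∃ g : R, g ≠ 0 ∧ ∀ p : Ideal R, p.IsPrime → g ∉ p →
      ∃ q : Ideal (Algebra.adjoin R (Set.range x)), q.IsPrime ∧
        q.comap (algebraMap R _) = p ∧ f ∉ q := by
  let e := hx.aevalEquiv.symm
  obtain ⟨m, hm⟩ := MvPolynomial.exists_coeff_ne_zero ((map_ne_zero_iff e e.injective).2 hf)
  refine ⟨_, hm, fun p hp hmp => ?_⟩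
  let φ : Algebra.adjoin R (Set.range x) →+* MvPolynomial σ (R ⧸ p) :=
    (MvPolynomial.map (Ideal.Quotient.mk p)).comp e.toRingHom
  refine ⟨RingHom.ker φ, RingHom.ker_isPrime φ, ?_, fun h => hmp ?_⟩
  · ext a
    have : φ (algebraMap R _ a) = MvPolynomial.C (Ideal.Quotient.mk p a) := by
      simp [φ, MvPolynomial.algebraMap_eq]
    rw [Ideal.mem_comap, RingHom.mem_ker, this, MvPolynomial.C_eq_zero, Ideal.Quotient.eq_zero_iff_mem]
  · rw [RingHom.mem_ker] at h
    have := congrArg (MvPolynomial.coeff m) h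
    rwa [RingHom.comp_apply, MvPolynomial.coeff_map, MvPolynomial.coeff_zero,
      Ideal.Quotient.eq_zero_iff_mem] at this

/-- Over a family of algebraically independent elements, followed by a finitely generated algebraic
extension, the primes avoiding a suitable nonzero element lift. -/
theorem AlgebraicIndependent.exists_forall_prime_exists_prime_comap_eq {R σ : Type*}
    {K : Type u} [CommRing R] [CommRing K] [IsDomain K] [Algebra R K] {x : σ → K}
    (hx : AlgebraicIndependent R x) (G : Finset K)
    (hG : ∀ z ∈ G, IsAlgebraic (Algebra.adjoin R (Set.range x)) z) :
    ∃ (S : Type u) (_ : CommRing S) (φ : R →+* S) (ψ : S →+* K), Function.Injective ψ ∧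
      (∀ r, ψ (φ r) = algebraMap R K r) ∧
      (∀ z ∈ Algebra.adjoin (Algebra.adjoin R (Set.range x)) (G : Set K), z ∈ ψ.range) ∧
      ∃ g : R, g ≠ 0 ∧ ∀ p : Ideal R, p.IsPrime → g ∉ p →
        ∃ q : Ideal S, q.IsPrime ∧ q.comap φ = p := by
  classical
  set R' := Algebra.adjoin R (Set.range x)
  let S := Algebra.adjoin R' (G : Set K)
  have halg : Algebra.IsAlgebraic R' S := by
    rw [← Subalgebra.isAlgebraic_iff]
    exact Algebra.adjoin_le_iff (S := Subalgebra.algebraicClosure R' K) |>.2 hG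
  have hfaith : FaithfulSMul R' S := (faithfulSMul_iff_algebraMap_injective R' S).2
    fun a b h => Subtype.ext (congrArg (Subtype.val : S → K) h)
  obtain ⟨g', hg', H'⟩ := Algebra.exists_forall_prime_exists_prime_over_of_isAlgebraic
    (R := R') (S := S) (G.preimage _ (Subtype.val_injective.injOn)) (by
      rw [Finset.coe_preimage]
      exact Algebra.adjoin_adjoin_coe_preimage)
  obtain ⟨g, hg, H⟩ := hx.exists_forall_prime_exists_prime_over hg'
  refine ⟨S, inferInstance, (algebraMap R' S).comp (algebraMap R R'), (S.val : S →+* K),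
    Subtype.val_injective, fun _ => rfl, fun z hz => ⟨⟨z, hz⟩, rfl⟩, g, hg, fun p hp hgp => ?_⟩
  obtain ⟨q', hq', hqp', hgq'⟩ := H p hp hgp
  obtain ⟨q, hq, hqp⟩ := H' q' hq' hgq'
  refine ⟨q, hq, ?_⟩
  rw [← hqp', ← hqp, Ideal.comap_comap]

/-! ### Rankings, leaders and reduction -/

open Polynomial

theorem natCast_mul_mem_iff {R : Type*} [CommRing R] [Algebra ℚ R] (I : Ideal R) {n : ℕ}
    (hn : n ≠ 0) {x : R} : (n : R) * x ∈ I ↔ x ∈ I := by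
  refine ⟨fun h => ?_, fun h => I.mul_mem_left _ h⟩
  have := I.mul_mem_left (algebraMap ℚ R (n : ℚ)⁻¹) h
  have hn' : (n : ℚ) ≠ 0 := Nat.cast_ne_zero.2 hn
  rwa [← mul_assoc, ← map_natCast (algebraMap ℚ R) n, ← map_mul, inv_mul_cancel₀ hn', map_one,
    one_mul] at this

/-- A family of algebra generators of a differential algebra that is permuted by the derivations,
indexed by a linear order compatible with the derivations (a ranking). -/
structure RankedGenerators (Δ A B ι : Type*) [CommRing A] [CommRing B] [DiffRing Δ B] [Algebra A B]
    [LinearOrder ι] where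
  /-- The action of the derivations on indices. -/
  shift : Δ → ι → ι
  /-- The family of generators. -/
  gen : ι → B
  shift_strictMono : ∀ d, StrictMono (shift d)
  lt_shift : ∀ d v, v < shift d v
  der_gen : ∀ d v, DiffRing.der d (gen v) = gen (shift d v)
  adjoin_range : Algebra.adjoin A (Set.range gen) = ⊤
  -- Dickson's property as an induction principle: a shift-stable set is generated under shifts by
  -- finitely many indices.
  exists_finset : ∀ L : Set ι, (∀ d, ∀ v ∈ L, shift d v ∈ L) → ∃ M : Finset ι, ↑M ⊆ L ∧
    ∀ P : ι → Prop, (∀ v ∈ M, P v) → (∀ d, ∀ v ∈ L, P v → P (shift d v)) → ∀ v ∈ L, P v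

namespace RankedGenerators

variable {Δ A B ι : Type*} [CommRing A] [CommRing B] [DiffRing Δ B] [Algebra A B]
  [LinearOrder ι] (Y : RankedGenerators Δ A B ι)

/-- The subalgebra generated by the generators of rank lower than `v`. -/
def lower (v : ι) : Subalgebra A B := Algebra.adjoin A (Y.gen '' Set.Iio v)

theorem gen_mem_lower {v w : ι} (h : v < w) : Y.gen v ∈ Y.lower w :=
  Algebra.subset_adjoin ⟨v, h, rfl⟩

theorem lower_mono {v w : ι} (h : v ≤ w) : Y.lower v ≤ Y.lower w :=
  Algebra.adjoin_mono (Set.image_mono (Set.Iio_subset_Iio h))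

theorem aeval_mem_lower {v w : ι} (h : v < w) (F : (Y.lower v)[X]) :
    aeval (Y.gen v) F ∈ Y.lower w := by
  rw [aeval_eq_sum_range]
  refine sum_mem fun i _ => ?_
  rw [Algebra.smul_def]
  exact mul_mem (Y.lower_mono h.le (F.coeff i).2) (pow_mem (Y.gen_mem_lower h) i)

/-- `v` is a leader for `q` if modulo `q` the generator of index `v` satisfies a nontrivial
algebraic relation over the generators of lower rank. -/
def IsLeader (q : Ideal B) (v : ι) : Prop :=
  ∃ F : (Y.lower v)[X], aeval (Y.gen v) F ∈ q ∧ (F.leadingCoeff : B) ∉ q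

theorem exists_mem_adjoin_Iic {T : Set ι} {x : B} (hx : x ∈ Algebra.adjoin A (Y.gen '' T)) :
    x ∈ Set.range (algebraMap A B) ∨ ∃ v ∈ T, x ∈ Algebra.adjoin A (Y.gen '' Set.Iic v) := by
  have mono : ∀ {v w : ι}, v ≤ w → Algebra.adjoin A (Y.gen '' Set.Iic v) ≤
      Algebra.adjoin A (Y.gen '' Set.Iic w) := fun h =>
    Algebra.adjoin_mono (Set.image_mono (Set.Iic_subset_Iic.2 h))
  have key : ∀ x z : B, ∀ op : B → B → B,
      (∀ U : Subalgebra A B, ∀ x ∈ U, ∀ z ∈ U, op x z ∈ U) →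
      (x ∈ Set.range (algebraMap A B) ∨ ∃ v ∈ T, x ∈ Algebra.adjoin A (Y.gen '' Set.Iic v)) →
      (z ∈ Set.range (algebraMap A B) ∨ ∃ v ∈ T, z ∈ Algebra.adjoin A (Y.gen '' Set.Iic v)) →
      (op x z ∈ Set.range (algebraMap A B) ∨
        ∃ v ∈ T, op x z ∈ Algebra.adjoin A (Y.gen '' Set.Iic v)) := by
    rintro x z op hop (⟨a, rfl⟩ | ⟨v, hv, hxv⟩) (⟨b, rfl⟩ | ⟨w, hw, hzw⟩)
    · exact Or.inl (Algebra.mem_bot.1 (hop ⊥ _ (Subalgebra.algebraMap_mem _ a) _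
        (Subalgebra.algebraMap_mem _ b)))
    · exact Or.inr ⟨w, hw, hop _ _ (Subalgebra.algebraMap_mem _ a) _ hzw⟩
    · exact Or.inr ⟨v, hv, hop _ _ hxv _ (Subalgebra.algebraMap_mem _ b)⟩
    · rcases le_total v w with h | h
      · exact Or.inr ⟨w, hw, hop _ _ (mono h hxv) _ hzw⟩
      · exact Or.inr ⟨v, hv, hop _ _ hxv _ (mono h hzw)⟩
  induction hx using Algebra.adjoin_induction with
  | mem x hx =>
    obtain ⟨v, hv, rfl⟩ := hx
    exact Or.inr ⟨v, hv, Algebra.subset_adjoin ⟨v, le_rfl, rfl⟩⟩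
  | algebraMap a => exact Or.inl ⟨a, rfl⟩
  | add x z _ _ hx hz => exact key x z (· + ·) (fun U _ h _ h' => U.add_mem h h') hx hz
  | mul x z _ _ hx hz => exact key x z (· * ·) (fun U _ h _ h' => U.mul_mem h h') hx hz

theorem exists_aeval_eq {v : ι} {x : B} (hx : x ∈ Algebra.adjoin A (Y.gen '' Set.Iic v)) :
    ∃ F : (Y.lower v)[X], aeval (Y.gen v) F = x := by
  have hle : Algebra.adjoin A (Y.gen '' Set.Iic v) ≤
      ((aeval (R := Y.lower v) (Y.gen v)).restrictScalars A).range := by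
    rw [Algebra.adjoin_le_iff]
    rintro _ ⟨w, hw, rfl⟩
    rcases (Set.mem_Iic.1 hw).lt_or_eq with h | rfl
    · exact ⟨C ⟨_, Y.gen_mem_lower h⟩, by simp⟩
    · exact ⟨X, by simp⟩
  exact hle hx

/-- Induction along the ranking for a containment of ideals. -/
theorem le_of_forall_aeval [WellFoundedLT ι] {q J : Ideal B}
    (hA : ∀ a : A, algebraMap A B a ∈ q → algebraMap A B a ∈ J)
    (h : ∀ v, (∀ x ∈ Y.lower v, x ∈ q → x ∈ J) →
      ∀ F : (Y.lower v)[X], aeval (Y.gen v) F ∈ q → aeval (Y.gen v) F ∈ J) : q ≤ J := by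
  have key : ∀ v, ∀ x ∈ Algebra.adjoin A (Y.gen '' Set.Iic v), x ∈ q → x ∈ J := by
    intro v
    induction v using WellFoundedLT.induction with
    | ind v ih =>
      intro x hx hxq
      obtain ⟨F, rfl⟩ := Y.exists_aeval_eq hx
      refine h v (fun z hz hzq => ?_) F hxq
      rcases Y.exists_mem_adjoin_Iic hz with ⟨a, rfl⟩ | ⟨w, hw, hzw⟩
      · exact hA a hzq
      · exact ih w hw z hzw hzq
  intro x hxq
  have hx : x ∈ Algebra.adjoin A (Y.gen '' Set.univ) := by
    rw [Set.image_univ, Y.adjoin_range]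
    trivial
  rcases Y.exists_mem_adjoin_Iic hx with ⟨a, rfl⟩ | ⟨w, -, hxw⟩
  · exact hA a hxq
  · exact key w x hxw hxq

/-- Once the leading coefficient is in `q`, erasing the leading term leaves a relation with fewer
terms. -/
theorem coeff_mem_of_forall_leadingCoeff_mem {q : Ideal B} {v : ι} {n : ℕ}
    (h : ∀ G : (Y.lower v)[X], aeval (Y.gen v) G ∈ q → G.natDegree < n → (G.leadingCoeff : B) ∈ q)
    (G : (Y.lower v)[X]) (hGq : aeval (Y.gen v) G ∈ q) (hGn : G.natDegree < n) (i : ℕ) :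
    (G.coeff i : B) ∈ q := by
  induction hk : G.support.card generalizing G with
  | zero =>
    rw [Finset.card_eq_zero, support_eq_empty] at hk
    simp [hk]
  | succ k ih =>
    have hlead := h G hGq hGn
    have herase : aeval (Y.gen v) G.eraseLead ∈ q := by
      rw [← G.eraseLead_add_monomial_natDegree_leadingCoeff, map_add, aeval_monomial] at hGq
      exact (q.add_mem_iff_left (q.mul_mem_right _ hlead)).1 hGq
    have := ih G.eraseLead herase ((eraseLead_natDegree_le_aux).trans_lt hGn)
      (by rw [card_support_eraseLead, hk]; rfl)
    rcases eq_or_ne i G.natDegree with rfl | hi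
    · exact hlead
    · rwa [eraseLead_coeff_of_ne i hi] at this

/-- Nontrivial relations of minimal degree. -/
theorem IsLeader.exists_minimal [Algebra ℚ B] {q : Ideal B} {v : ι} (hv : Y.IsLeader q v) :
    ∃ F : (Y.lower v)[X], aeval (Y.gen v) F ∈ q ∧ (F.leadingCoeff : B) ∉ q ∧ 0 < F.natDegree ∧
      aeval (Y.gen v) (derivative F) ∉ q ∧
      ∀ G : (Y.lower v)[X], aeval (Y.gen v) G ∈ q → G.natDegree < F.natDegree →
        ∀ i, (G.coeff i : B) ∈ q := by
  classical
  have hex : ∃ n, ∃ F : (Y.lower v)[X], (aeval (Y.gen v) F ∈ q ∧ (F.leadingCoeff : B) ∉ q) ∧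
      F.natDegree = n := by
    obtain ⟨F, hF⟩ := hv
    exact ⟨_, F, hF, rfl⟩
  obtain ⟨F, ⟨hFq, hFl⟩, hFn⟩ := Nat.find_spec hex
  have hmin : ∀ G : (Y.lower v)[X], aeval (Y.gen v) G ∈ q → G.natDegree < F.natDegree →
      ∀ i, (G.coeff i : B) ∈ q := Y.coeff_mem_of_forall_leadingCoeff_mem fun G hGq hGn => by
    by_contra hl
    exact Nat.find_min hex (hFn ▸ hGn) ⟨G, ⟨hGq, hl⟩, rfl⟩
  have hpos : 0 < F.natDegree := by
    by_contra h
    rw [eq_C_of_natDegree_eq_zero (by omega : F.natDegree = 0)] at hFq hFl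
    rw [aeval_C] at hFq
    rw [leadingCoeff_C] at hFl
    exact hFl hFq
  refine ⟨F, hFq, hFl, hpos, fun h => hFl ?_, hmin⟩
  -- If the separant were in `q`, minimality would put its top coefficient, the degree of `F` times
  -- the leading coefficient of `F`, in `q`; over `ℚ` the factor can be cancelled.
  have := hmin _ h (natDegree_derivative_lt hpos.ne') (F.natDegree - 1)
  rw [coeff_derivative, Nat.sub_add_cancel hpos, coeff_natDegree] at this
  rw [← natCast_mul_mem_iff q hpos.ne', mul_comm]
  convert this using 1
  have : ((F.natDegree - 1 : ℕ) : Y.lower v) + 1 = F.natDegree := by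
    rw [← Nat.cast_add_one, Nat.sub_add_cancel hpos]
  rw [this]
  push_cast
  rfl

/-- Modulo `J`, the generator of index `v` is a quotient of lower terms with denominator in `H`. -/
def IsLinear (J : Ideal B) (H : Set B) (v : ι) : Prop :=
  ∃ s ∈ H, s ∈ Y.lower v ∧ ∃ g ∈ Y.lower v, s * Y.gen v - g ∈ J

theorem IsLinear.exists_aeval_mem {J : Ideal B} {H : Set B} (hH : (0 : B) ∉ H) {v : ι}
    (h : Y.IsLinear J H v) : ∃ F : (Y.lower v)[X], aeval (Y.gen v) F ∈ J ∧
      (F.leadingCoeff : B) ∈ H ∧ F.natDegree = 1 := by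
  obtain ⟨s, hs, hsv, g, hg, hJg⟩ := h
  have hs0 : (⟨s, hsv⟩ : Y.lower v) ≠ 0 := fun h => hH (by
    have : s = 0 := congrArg Subtype.val h
    exact this ▸ hs)
  refine ⟨C ⟨s, hsv⟩ * X + C (-⟨g, hg⟩), ?_, ?_, natDegree_linear hs0⟩
  · convert hJg using 1
    simp [sub_eq_add_neg]
  · rw [leadingCoeff_linear hs0]
    exact hs

variable [DiffRing Δ A] [IsDiffAlgebra Δ A B]

theorem der_mem_lower {v : ι} {x : B} (hx : x ∈ Y.lower v) (d : Δ) :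
    DiffRing.der d x ∈ Y.lower (Y.shift d v) := by
  have hle := Y.lower_mono (Y.lt_shift d v).le
  unfold lower at hx
  induction hx using Algebra.adjoin_induction with
  | mem x hx =>
    obtain ⟨w, hw, rfl⟩ := hx
    rw [Y.der_gen]
    exact Y.gen_mem_lower (Y.shift_strictMono d hw)
  | algebraMap a =>
    rw [IsDiffAlgebra.der_algebraMap]
    exact Subalgebra.algebraMap_mem _ _
  | add x z _ _ hx hz =>
    rw [map_add]
    exact add_mem hx hz
  | mul x z hx' hz' hx hz =>
    rw [Derivation.leibniz, smul_eq_mul, smul_eq_mul]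
    exact add_mem (mul_mem (hle hx') hz) (mul_mem (hle hz') hx)

/-- Only differentiating `Y.gen v` itself produces the new generator, and it does so linearly, with
the separant as coefficient. -/
theorem der_aeval_sub_mem_lower {v : ι} (F : (Y.lower v)[X]) (d : Δ) :
    DiffRing.der d (aeval (Y.gen v) F) - aeval (Y.gen v) (derivative F) * Y.gen (Y.shift d v) ∈
      Y.lower (Y.shift d v) := by
  induction F using Polynomial.induction_on' with
  | add F G hF hG =>
    convert add_mem hF hG using 1
    simp only [map_add]
    ring
  | monomial n c =>
    have := mul_mem (Y.der_mem_lower c.2 d) (pow_mem (Y.gen_mem_lower (Y.lt_shift d v)) n)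
    convert this using 1
    rw [derivative_monomial, aeval_monomial, aeval_monomial, Derivation.leibniz,
      Derivation.leibniz_pow, Y.der_gen]
    simp only [smul_eq_mul, nsmul_eq_mul, map_mul, map_natCast, Subalgebra.algebraMap_def,
      Algebra.algebraMap_self_apply]
    ring

theorem isLinear_shift_of_aeval_mem {J : Ideal B} (hJ : IsDiffIdeal Δ J) {H : Set B} {v : ι}
    {F : (Y.lower v)[X]} (hF : aeval (Y.gen v) F ∈ J)
    (hH : aeval (Y.gen v) (derivative F) ∈ H) (d : Δ) : Y.IsLinear J H (Y.shift d v) := by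
  refine ⟨_, hH, Y.aeval_mem_lower (Y.lt_shift d v) _, _,
    neg_mem (Y.der_aeval_sub_mem_lower F d), ?_⟩
  convert hJ d _ hF using 1
  ring

/-- Further differentiation keeps the same denominator `s`; this is why a finite `H` suffices for
all derivatives. -/
theorem IsLinear.shift {J : Ideal B} (hJ : IsDiffIdeal Δ J) {H : Set B} {v : ι}
    (h : Y.IsLinear J H v) (d : Δ) : Y.IsLinear J H (Y.shift d v) := by
  obtain ⟨s, hs, hsv, g, hg, hJg⟩ := h
  have hle := Y.lower_mono (Y.lt_shift d v).le
  refine ⟨s, hs, hle hsv, DiffRing.der d g - DiffRing.der d s * Y.gen v,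
    sub_mem (Y.der_mem_lower hg d)
      (mul_mem (Y.der_mem_lower hsv d) (Y.gen_mem_lower (Y.lt_shift d v))), ?_⟩
  convert hJ d _ hJg using 1
  rw [map_sub, Derivation.leibniz, Y.der_gen]
  simp only [smul_eq_mul]
  ring

theorem IsLeader.shift [Algebra ℚ B] {q : Ideal B} (hqd : IsDiffIdeal Δ q) {v : ι}
    (hv : Y.IsLeader q v) (d : Δ) : Y.IsLeader q (Y.shift d v) := by
  obtain ⟨F, hFq, -, -, hF', -⟩ := hv.exists_minimal Y
  have hlin : Y.IsLinear q {aeval (Y.gen v) (derivative F)} (Y.shift d v) :=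
    Y.isLinear_shift_of_aeval_mem hqd hFq (Set.mem_singleton _) d
  obtain ⟨G, hGq, hG, -⟩ := hlin.exists_aeval_mem Y
    (fun h => hF' (by rw [← Set.mem_singleton_iff.1 h]; exact q.zero_mem))
  exact ⟨G, hGq, fun h => hF' (Set.mem_singleton_iff.1 hG ▸ h)⟩

/-- A finite set `G` of relations in `q` and a finite set `H` of denominators outside of `q` that
suffice to reduce all leaders. -/
theorem exists_finset_relations [Algebra ℚ B] {q : Ideal B}
    (hqd : IsDiffIdeal Δ q) :
    ∃ (G H : Finset B) (M : Finset ι), (∀ g ∈ G, g ∈ q) ∧ (∀ h ∈ H, h ∉ q) ∧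
      ∀ J : Ideal B, IsDiffIdeal Δ J → (∀ g ∈ G, g ∈ J) → ∀ v, Y.IsLeader q v →
        (v ∈ M ∨ Y.IsLinear J H v) ∧ ∃ F : (Y.lower v)[X], aeval (Y.gen v) F ∈ J ∧
          (F.leadingCoeff : B) ∈ H ∧ 0 < F.natDegree ∧
          ∀ G : (Y.lower v)[X], aeval (Y.gen v) G ∈ q → G.natDegree < F.natDegree →
            ∀ i, (G.coeff i : B) ∈ q := by
  classical
  have hmin := fun v (hv : Y.IsLeader q v) => hv.exists_minimal Y
  choose! F hFq hFl hFn hF' hFm using hmin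
  obtain ⟨M, hML, hM⟩ := Y.exists_finset {v | Y.IsLeader q v} (fun d v hv => hv.shift Y hqd d)
  -- `G` holds the minimal relations of the basic leaders, `H` their leading coefficients and
  -- separants.
  refine ⟨M.image fun v => aeval (Y.gen v) (F v), (M.image fun v => ((F v).leadingCoeff : B)) ∪
    M.image fun v => aeval (Y.gen v) (derivative (F v)), M, ?_, ?_, ?_⟩
  · intro g hg
    obtain ⟨v, hv, rfl⟩ := Finset.mem_image.1 hg
    exact hFq v (hML hv)
  · intro h hh
    rcases Finset.mem_union.1 hh with hh | hh
    all_goals obtain ⟨v, hv, rfl⟩ := Finset.mem_image.1 hh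
    · exact hFl v (hML hv)
    · exact hF' v (hML hv)
  intro J hJ hGJ
  set H := (M.image fun v => ((F v).leadingCoeff : B)) ∪
    M.image fun v => aeval (Y.gen v) (derivative (F v)) with hH
  have hH0 : (0 : B) ∉ (H : Set B) := by
    intro h
    rcases Finset.mem_union.1 (Finset.mem_coe.1 h) with hh | hh
    all_goals obtain ⟨v, hv, hv0⟩ := Finset.mem_image.1 hh
    · exact hFl v (hML hv) (hv0 ▸ q.zero_mem)
    · exact hF' v (hML hv) (hv0 ▸ q.zero_mem)
  have hGJ' : ∀ v ∈ M, aeval (Y.gen v) (F v) ∈ J := fun v hv =>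
    hGJ _ (Finset.mem_image_of_mem _ hv)
  have hlin : ∀ v, Y.IsLeader q v → v ∈ M ∨ Y.IsLinear J H v := by
    refine hM _ (fun v hv => Or.inl hv) ?_
    rintro d v - (hv | hv)
    · refine Or.inr (Y.isLinear_shift_of_aeval_mem hJ (hGJ' v hv) ?_ d)
      exact Finset.mem_coe.2 (Finset.mem_union_right _ (Finset.mem_image.2 ⟨v, hv, rfl⟩))
    · exact Or.inr (hv.shift Y hJ d)
  intro v hv
  refine ⟨hlin v hv, ?_⟩
  rcases hlin v hv with hvM | hvl
  · exact ⟨F v, hGJ' v hvM, Finset.mem_union_left _ (Finset.mem_image_of_mem _ hvM), hFn v hv,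
      hFm v hv⟩
  · obtain ⟨E, hEJ, hEH, hE⟩ := hvl.exists_aeval_mem Y hH0
    refine ⟨E, hEJ, hEH, hE ▸ one_pos, fun D hD hDn i => ?_⟩
    rw [hE, Nat.lt_one_iff] at hDn
    rw [eq_C_of_natDegree_eq_zero hDn, aeval_C] at hD
    rcases eq_or_ne i 0 with rfl | hi
    · exact hD
    · rw [eq_C_of_natDegree_eq_zero hDn, coeff_C_of_ne_zero hi]
      exact q.zero_mem

/-- A differential prime ideal `q` is determined, up to inverting finitely many elements outside of
`q`, by its contraction and finitely many of its elements. -/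
theorem exists_finset_le (Y : RankedGenerators Δ A B ι) [WellFoundedLT ι] [Algebra ℚ B] {q : Ideal B} (hq : q.IsPrime)
    (hqd : IsDiffIdeal Δ q) :
    ∃ G : Finset B, (∀ g ∈ G, g ∈ q) ∧ ∃ s ∉ q, ∀ J : Ideal B, IsDiffIdeal Δ J →
      J ≤ q → (∀ g ∈ G, g ∈ J) → (∀ a : A, algebraMap A B a ∈ q → algebraMap A B a ∈ J) →
      (∀ x, s * x ∈ J → x ∈ J) → q ≤ J := by
  obtain ⟨G, H, M, hGq, hHq, hrel⟩ := Y.exists_finset_relations hqd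
  refine ⟨G, hGq, ∏ h ∈ H, h, fun h => ?_, fun J hJ hJq hGJ hAJ hsat => ?_⟩
  · obtain ⟨h, hh, hhq⟩ := hq.prod_mem_iff.1 h
    exact hHq h hh hhq
  have hsat' : ∀ h ∈ H, ∀ x, h * x ∈ J → x ∈ J := fun h hh x hx => hsat x (by
    obtain ⟨c, hc⟩ := Finset.dvd_prod_of_mem (fun h => h) hh
    rw [hc, mul_right_comm]
    exact J.mul_mem_right _ hx)
  refine Y.le_of_forall_aeval hAJ fun v hlow => ?_
  have hcoeff : ∀ D : (Y.lower v)[X], (∀ i, (D.coeff i : B) ∈ q) → aeval (Y.gen v) D ∈ J := by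
    intro D hD
    rw [aeval_eq_sum_range]
    refine J.sum_mem fun i _ => ?_
    rw [Algebra.smul_def]
    exact J.mul_mem_right _ (hlow _ (D.coeff i).2 (hD i))
  by_cases hv : Y.IsLeader q v
  -- Pseudo-division by `F`: each step multiplies by its leading coefficient, which saturation
  -- cancels. Below the degree of `F` all coefficients lie in `q`, hence in `J` by the induction on
  -- rank.
  · obtain ⟨-, F, hFJ, hFH, hFn, hFm⟩ := hrel J hJ hGJ v hv
    intro D
    induction hn : D.natDegree using Nat.strong_induction_on generalizing D with
    | _ n ih =>
      intro hDq
      rcases lt_or_ge D.natDegree F.natDegree with hlt | hle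
      · exact hcoeff D (hFm D hDq hlt)
      · have hlt := natDegree_cancelLeads_lt_of_natDegree_le_natDegree_of_comm
          (mul_comm F.leadingCoeff D.leadingCoeff) hle (hFn.trans_le hle)
        have hc : aeval (Y.gen v) (F.cancelLeads D) = (F.leadingCoeff : B) * aeval (Y.gen v) D -
            (D.leadingCoeff : B) * Y.gen v ^ (D.natDegree - F.natDegree) * aeval (Y.gen v) F := by
          rw [cancelLeads, Nat.sub_eq_zero_of_le hle]
          simp
        have := ih _ (hn ▸ hlt) (F.cancelLeads D) rfl (by
          rw [hc]
          exact q.sub_mem (q.mul_mem_left _ hDq) (q.mul_mem_left _ (hJq hFJ)))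
        rw [hc, J.sub_mem_iff_left (J.mul_mem_left _ hFJ)] at this
        exact hsat' _ hFH _ this
  · intro D hDq
    refine hcoeff D (Y.coeff_mem_of_forall_leadingCoeff_mem (fun E hE _ => ?_) D hDq
      (Nat.lt_succ_self _))
    by_contra hl
    exact hv ⟨E, hE, hl⟩

end RankedGenerators

/-! ### Existence of rankings -/

/-- Dickson's lemma for sets of exponents closed under adding unit vectors. -/
theorem Finsupp.exists_finset_of_forall_add_single_mem {Δ κ : Type*} [Finite Δ] [Finite κ]
    (L : Set ((Δ →₀ ℕ) × κ))
    (hL : ∀ d, ∀ v ∈ L, (v.1 + Finsupp.single d 1, v.2) ∈ L) :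
    ∃ M : Finset ((Δ →₀ ℕ) × κ), ↑M ⊆ L ∧ ∀ P : (Δ →₀ ℕ) × κ → Prop, (∀ v ∈ M, P v) →
      (∀ d, ∀ v ∈ L, P v → P (v.1 + Finsupp.single d 1, v.2)) → ∀ v ∈ L, P v := by
  classical
  let m : κ → Set (Δ →₀ ℕ) := fun i => {θ | Minimal (fun θ => (θ, i) ∈ L) θ}
  have hm : ∀ i, (m i).Finite := fun i =>
    WellQuasiOrderedLE.finite_of_isAntichain (setOfPred_minimal_antichain _)
  have hfin : {v : (Δ →₀ ℕ) × κ | v.1 ∈ m v.2}.Finite := by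
    refine (Set.finite_iUnion fun i => (hm i).image fun θ => (θ, i)).subset ?_
    rintro ⟨θ, i⟩ h
    exact Set.mem_iUnion.2 ⟨i, θ, h, rfl⟩
  refine ⟨hfin.toFinset, fun v hv => ?_, fun P hM hP v hv => ?_⟩
  · have h : Minimal (fun θ => (θ, v.2) ∈ L) v.1 := hfin.mem_toFinset.1 hv
    exact h.prop
  · obtain ⟨θ, i⟩ := v
    obtain ⟨θ₀, hle, hmin⟩ := exists_minimal_le_of_wellFoundedLT (fun θ => (θ, i) ∈ L) θ hv
    obtain ⟨η, rfl⟩ := exists_add_of_le hle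
    have key : ∀ η : Δ →₀ ℕ, (θ₀ + η, i) ∈ L ∧ P (θ₀ + η, i) := by
      intro η
      induction η using Finsupp.induction with
      | zero => exact ⟨by simpa using hmin.prop, by simpa using hM _ (hfin.mem_toFinset.2 hmin)⟩
      | single_add d k η _ _ ih =>
        clear * - ih hP hL
        induction k with
        | zero => simpa using ih
        | succ k ihk =>
          have heq : θ₀ + (Finsupp.single d (k + 1) + η) =
              θ₀ + (Finsupp.single d k + η) + Finsupp.single d 1 := by
            rw [Finsupp.single_add]
            ac_rfl
          rw [heq]
          exact ⟨hL d _ ihk.1, hP d _ ihk.1 ihk.2⟩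
    exact (key η).2

open scoped IsMulCommutative in
-- The indices are pairs of a derivation monomial and an element of `S`, ordered by
-- degree-lexicographic order first.
theorem IsDiffFG.exists_rankedGenerators {Δ : Type u} {A B : Type*} [Finite Δ] [CommRing A] [CommRing B]
    [DiffRing Δ A] [DiffRing Δ B] [Algebra A B] [IsDiffAlgebra Δ A B] (hfg : IsDiffFG Δ A B) :
    ∃ (ι : Type u) (_ : LinearOrder ι) (_ : WellFoundedLT ι),
      Nonempty (RankedGenerators Δ A B ι) := by
  classical
  obtain ⟨S, hS⟩ := hfg
  let e := Finite.equivFin Δ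
  let : LinearOrder Δ := LinearOrder.lift' e e.injective
  let f : Δ → Module.End ℤ B := fun d => (DiffRing.der d).toLinearMap
  -- Commutativity of the generated operators gives sense to the product over a finitely supported
  -- exponent.
  have := Submonoid.isMulCommutative_closure (Module.End ℤ B) (s := Set.range f) (by
    rintro _ ⟨d, rfl⟩ _ ⟨d', rfl⟩
    ext x
    exact DiffRing.der_comm d d' x)
  let X : Δ → Submonoid.closure (Set.range f) := fun d => ⟨f d, Submonoid.subset_closure ⟨d, rfl⟩⟩
  let D : (Δ →₀ ℕ) → Submonoid.closure (Set.range f) := fun θ => θ.prod fun d k => X d ^ k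
  have hD0 : D 0 = 1 := Finsupp.prod_zero_index
  have hD : ∀ θ d, D (θ + Finsupp.single d 1) = X d * D θ := by
    intro θ d
    simp only [D]
    rw [Finsupp.prod_add_index' (by simp) (by simp [pow_add]), mul_comm]
    simp
  let g : (Δ →₀ ℕ) × Fin S.card → B := fun v =>
    (D v.1 : Module.End ℤ B) (S.equivFin.symm v.2 : B)
  have hder : ∀ d v, DiffRing.der d (g v) = g (v.1 + Finsupp.single d 1, v.2) := by
    intro d v
    simp only [g, hD]
    rfl
  have hlt : ∀ (d : Δ) (θ : DegLex (Δ →₀ ℕ)), θ < θ + toDegLex (Finsupp.single d 1) := by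
    intro d θ
    refine lt_add_of_pos_right _ (Finsupp.DegLex.lt_iff.2 (Or.inl ?_))
    change Finsupp.degree (0 : Δ →₀ ℕ) < Finsupp.degree (Finsupp.single d 1)
    simp
  refine ⟨Lex (DegLex (Δ →₀ ℕ) × Fin S.card), inferInstance, inferInstance, ⟨{
    shift := fun d v => toLex ((ofLex v).1 + toDegLex (Finsupp.single d 1), (ofLex v).2)
    gen := fun v => g (ofLex v)
    shift_strictMono := ?_
    lt_shift := ?_
    der_gen := fun d v => hder d (ofLex v)
    adjoin_range := ?_
    exists_finset := fun L hL => Finsupp.exists_finset_of_forall_add_single_mem L hL }⟩⟩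
  · intro d v w h
    rw [Prod.Lex.lt_iff] at h
    refine Prod.Lex.lt_iff.2 (h.imp (fun h => ?_) (fun h => ?_))
    · exact add_lt_add_left h _
    · exact ⟨congrArg (· + toDegLex (Finsupp.single d 1)) h.1, h.2⟩
  · intro d v
    exact Prod.Lex.lt_iff.2 (Or.inl (hlt d _))
  · rw [eq_top_iff, ← hS]
    refine sInf_le ⟨fun x hx => Algebra.subset_adjoin ⟨toLex (0, S.equivFin ⟨x, hx⟩), ?_⟩,
      fun d x hx => ?_⟩
    · have : g (0, S.equivFin ⟨x, hx⟩) = x := by simp [g, hD0]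
      exact this
    · induction hx using Algebra.adjoin_induction with
      | mem x hx =>
        obtain ⟨v, rfl⟩ := hx
        rw [hder]
        exact Algebra.subset_adjoin ⟨toLex _, rfl⟩
      | algebraMap a =>
        rw [IsDiffAlgebra.der_algebraMap]
        exact Subalgebra.algebraMap_mem _ _
      | add x z _ _ hx hz =>
        rw [map_add]
        exact add_mem hx hz
      | mul x z hx' hz' hx hz =>
        rw [Derivation.leibniz, smul_eq_mul, smul_eq_mul]
        exact add_mem (mul_mem hx' hz) (mul_mem hz' hx)

/-! ### Differential ideals and finite bases -/

section DiffIdeal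

variable {Δ R : Type*} [CommRing R] [DiffRing Δ R]

/-- Differentiation trades one factor `x` for two factors `d x`, until a pure power of `d x`
remains; the integer coefficients are invertible. -/
theorem IsDiffIdeal.radical [Algebra ℚ R] {I : Ideal R} (hI : IsDiffIdeal Δ I) :
    IsDiffIdeal Δ I.radical := by
  rintro d x ⟨n, hn⟩
  have key : ∀ k ≤ n, x ^ (n - k) * (DiffRing.der d x) ^ (2 * k) ∈ I := by
    intro k
    induction k with
    | zero => simpa using hn
    | succ k ih =>
      intro hk
      obtain ⟨m, rfl⟩ : ∃ m, n = m + 1 + k := ⟨n - (k + 1), by omega⟩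
      have h := ih (by omega)
      rw [show m + 1 + k - k = m + 1 by omega] at h
      rw [show m + 1 + k - (k + 1) = m by omega]
      set y := DiffRing.der d x with hy
      have hd : y * DiffRing.der d (x ^ (m + 1) * y ^ (2 * k)) -
          ((2 * k : ℕ) : R) * DiffRing.der d y * (x ^ (m + 1) * y ^ (2 * k)) =
          ((m + 1 : ℕ) : R) * (x ^ m * y ^ (2 * (k + 1))) := by
        rw [Derivation.leibniz, Derivation.leibniz_pow, Derivation.leibniz_pow, ← hy]
        simp only [smul_eq_mul, nsmul_eq_mul, Nat.add_sub_cancel]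
        rcases k with _ | k
        · simp
          ring
        · rw [show 2 * (k + 1) - 1 = 2 * k + 1 by omega]
          ring
      rw [← natCast_mul_mem_iff I (Nat.succ_ne_zero m), ← hd]
      exact I.sub_mem (I.mul_mem_left _ (hI d _ h)) (I.mul_mem_left _ h)
  refine ⟨2 * n, ?_⟩
  simpa using key n le_rfl

/-- The square of `y * d x` is in `I`. Consequently colon ideals of radical differential ideals are
differential. -/
theorem IsDiffIdeal.mul_der_mem {I : Ideal R} (hI : IsDiffIdeal Δ I) (hr : I.IsRadical) {x y : R}
    (h : y * x ∈ I) (d : Δ) : y * DiffRing.der d x ∈ I := by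
  refine hr ⟨2, ?_⟩
  have := I.sub_mem (I.mul_mem_left (y * DiffRing.der d x) (hI d _ h))
    (I.mul_mem_left (DiffRing.der d x * DiffRing.der d y) h)
  convert this using 1
  rw [Derivation.leibniz, smul_eq_mul, smul_eq_mul]
  ring

theorem IsDiffIdeal.sSup {s : Set (Ideal R)} (hs : ∀ I ∈ s, IsDiffIdeal Δ I) :
    IsDiffIdeal Δ (sSup s) := by
  intro d x hx
  rw [sSup_eq_iSup'] at hx
  refine Submodule.iSup_induction _ (motive := fun x => DiffRing.der d x ∈ _) hx
    (fun I x hx => le_sSup I.2 (hs I I.2 d x hx)) (by simp) fun x y hx hy => ?_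
  rw [map_add]
  exact add_mem hx hy

theorem IsDiffIdeal.map {S : Type*} [CommRing S] [DiffRing Δ S] [Algebra R S] [IsDiffAlgebra Δ R S]
    {I : Ideal R} (hI : IsDiffIdeal Δ I) : IsDiffIdeal Δ (I.map (algebraMap R S)) := by
  intro d x hx
  induction hx using Submodule.span_induction with
  | mem x hx =>
    obtain ⟨a, ha, rfl⟩ := hx
    rw [IsDiffAlgebra.der_algebraMap]
    exact Ideal.mem_map_of_mem _ (hI d a ha)
  | zero => simp
  | add x y _ _ hx hy =>
    rw [map_add]
    exact add_mem hx hy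
  | smul c x hx' hx =>
    rw [smul_eq_mul, Derivation.leibniz, smul_eq_mul, smul_eq_mul]
    exact add_mem (Ideal.mul_mem_left _ _ hx) (Ideal.mul_mem_right _ _ hx')

/-- In a Ritt algebra the largest differential ideal contained in a prime ideal is prime. -/
theorem Ideal.IsPrime.exists_isDiffIdeal_isPrime_le [Algebra ℚ R] {N : Ideal R} (hN : N.IsPrime) :
    ∃ q : Ideal R, q.IsPrime ∧ IsDiffIdeal Δ q ∧ q ≤ N ∧
      ∀ I : Ideal R, IsDiffIdeal Δ I → I ≤ N → I ≤ q := by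
  let q : Ideal R := sSup {I | IsDiffIdeal Δ I ∧ I ≤ N}
  have hqN : q ≤ N := sSup_le fun I hI => hI.2
  have hq : IsDiffIdeal Δ q := IsDiffIdeal.sSup fun I hI => hI.1
  have hmax : ∀ I : Ideal R, IsDiffIdeal Δ I → I ≤ N → I ≤ q := fun I hI hIN => le_sSup ⟨hI, hIN⟩
  have hr : q.IsRadical := hmax _ hq.radical (hN.radical_le_iff.2 hqN)
  have hcolon : ∀ y, IsDiffIdeal Δ (Submodule.comap (LinearMap.mulLeft R y) q : Ideal R) :=
    fun y d x hx => hq.mul_der_mem hr hx d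
  refine ⟨q, Ideal.isPrime_iff.2 ⟨fun h => hN.ne_top (top_le_iff.1 (h ▸ hqN)), ?_⟩, hq, hqN, hmax⟩
  intro x y hxy
  by_cases hle : (Submodule.comap (LinearMap.mulLeft R y) q : Ideal R) ≤ N
  · exact Or.inl (hmax _ (hcolon y) hle (by simpa [mul_comm y x] using hxy))
  -- Here `y * z ∈ q` with `z ∉ N`, so the colon ideal of `q` by `z` lies in the prime `N`; being
  -- differential it lies in `q`, and it contains `y`.
  · obtain ⟨z, hz, hzN⟩ := SetLike.not_le_iff_exists.1 hle
    refine Or.inr (hmax _ (hcolon z) (fun w hw => ?_) (by simpa [mul_comm z y] using hz))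
    exact (hN.mem_or_mem (hqN hw)).resolve_left hzN

/-- A Zorn's lemma argument: ideals maximal for the failure of suitable properties are prime
differential ideals. -/
theorem exists_isPrime_isDiffIdeal_not (P : Ideal R → Prop)
    (hchain : ∀ c : Set (Ideal R), c.Nonempty → IsChain (· ≤ ·) c → P (sSup c) → ∃ I ∈ c, P I)
    (htop : P ⊤)
    (hmul : ∀ (I : Ideal R) (a b : R), a * b ∈ I → P (I ⊔ Ideal.span {a}) →
      P (I ⊔ Ideal.span {b}) → P I)
    (hder : ∀ (I : Ideal R) (d : Δ), ∀ x ∈ I, P (I ⊔ Ideal.span {DiffRing.der d x}) → P I)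
    {I : Ideal R} (hI : ¬ P I) :
    ∃ q : Ideal R, q.IsPrime ∧ IsDiffIdeal Δ q ∧ ¬ P q ∧ ∀ b ∉ q, P (q ⊔ Ideal.span {b}) := by
  obtain ⟨q, -, hq⟩ := zorn_le_nonempty₀ {I | ¬ P I} (fun c hc hch J hJ => ⟨sSup c, fun h => by
    obtain ⟨K, hK, hPK⟩ := hchain c ⟨J, hJ⟩ hch h
    exact hc hK hPK, fun K hK => le_sSup hK⟩) I hI
  have hb : ∀ b ∉ q, P (q ⊔ Ideal.span {b}) := by
    intro b hb
    by_contra h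
    exact hb (hq.2 h le_sup_left (Ideal.mem_sup_right (Ideal.mem_span_singleton_self b)))
  refine ⟨q, Ideal.isPrime_iff.2 ⟨fun h => hq.1 (h ▸ htop), fun {a b} hab => ?_⟩,
    fun d x hx => ?_, hq.1, hb⟩
  · by_contra! h
    exact hq.1 (hmul q a b hab (hb a h.1) (hb b h.2))
  · by_contra h
    exact hq.1 (hder q d x hx (hb _ h))

variable (Δ) in
/-- The closed subset of the differential spectrum defined by `I` is defined by finitely many
elements of `I`. -/
def HasFiniteBasis (I : Ideal R) : Prop :=
  ∃ G : Finset R, (∀ g ∈ G, g ∈ I) ∧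
    ∀ p : Ideal R, p.IsPrime → IsDiffIdeal Δ p → (∀ g ∈ G, g ∈ p) → I ≤ p

theorem HasFiniteBasis.exists_mem_of_isChain {c : Set (Ideal R)} (h : HasFiniteBasis Δ (sSup c))
    (hne : c.Nonempty) (hc : IsChain (· ≤ ·) c) :
    ∃ J ∈ c, ∃ G : Finset R, (∀ g ∈ G, g ∈ J) ∧
      ∀ p : Ideal R, p.IsPrime → IsDiffIdeal Δ p → (∀ g ∈ G, g ∈ p) → sSup c ≤ p := by
  classical
  obtain ⟨G, hG, hp⟩ := h
  obtain ⟨J, hJ, hGJ⟩ : ∃ J ∈ c, ∀ g ∈ G, g ∈ J := by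
    clear hp
    induction G using Finset.induction_on with
    | empty =>
      obtain ⟨J, hJ⟩ := hne
      exact ⟨J, hJ, by simp⟩
    | insert g G _ ih =>
      obtain ⟨J, hJ, hGJ⟩ := ih fun g hg => hG g (Finset.mem_insert_of_mem hg)
      obtain ⟨J', hJ', hgJ'⟩ := (Submodule.mem_sSup_of_directed hne hc.directedOn).1
        (hG g (Finset.mem_insert_self _ _))
      rcases hc.total hJ hJ' with h | h
      · exact ⟨J', hJ', Finset.forall_mem_insert _ _ _ |>.2 ⟨hgJ', fun g hg => h (hGJ g hg)⟩⟩
      · exact ⟨J, hJ, Finset.forall_mem_insert _ _ _ |>.2 ⟨h hgJ', hGJ⟩⟩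
  exact ⟨J, hJ, G, hGJ, hp⟩

/-- Basis elements can be moved into `I` by subtracting multiples of `b`, which is harmless where `b
∈ p`. -/
theorem HasFiniteBasis.of_sup_span {I : Ideal R} {b : R}
    (h : HasFiniteBasis Δ (I ⊔ Ideal.span {b})) :
    ∃ G : Finset R, (∀ g ∈ G, g ∈ I) ∧
      ∀ p : Ideal R, p.IsPrime → IsDiffIdeal Δ p → (∀ g ∈ G, g ∈ p) → b ∈ p → I ≤ p := by
  classical
  obtain ⟨G, hG, hp⟩ := h
  have : ∀ g ∈ G, ∃ x ∈ I, g - x ∈ Ideal.span {b} := by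
    intro g hg
    obtain ⟨x, hx, z, hz, rfl⟩ := Submodule.mem_sup.1 (hG g hg)
    exact ⟨x, hx, by simpa using hz⟩
  choose! f hf hfb using this
  refine ⟨G.image f, fun g hg => ?_, fun p hpp hpd hGp hb => ?_⟩
  · obtain ⟨x, hx, rfl⟩ := Finset.mem_image.1 hg
    exact hf x hx
  · refine le_sup_left.trans (hp p hpp hpd fun g hg => ?_)
    have h1 := hGp _ (Finset.mem_image_of_mem f hg)
    have h2 := (Ideal.span_singleton_le_iff_mem p).2 hb (hfb g hg)
    simpa using p.add_mem h1 h2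

theorem hasFiniteBasis_of_noetherianSpace [TopologicalSpace.NoetherianSpace (DiffSpec Δ R)]
    (I : Ideal R) : HasFiniteBasis Δ I := by
  classical
  let U : I → Set (DiffSpec Δ R) := fun x => {p | (x : R) ∉ p.1.asIdeal}
  have hU : ∀ x, IsOpen (U x) := fun x =>
    (PrimeSpectrum.isOpen_basicOpen (a := (x : R))).preimage continuous_subtype_val
  obtain ⟨t, ht⟩ := (TopologicalSpace.NoetherianSpace.isCompact (⋃ x, U x)).elim_finite_subcover U hU
    le_rfl
  refine ⟨t.image (Subtype.val : I → R), fun g hg => ?_, fun p hp hpd hG x hx => ?_⟩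
  · obtain ⟨x, -, rfl⟩ := Finset.mem_image.1 hg
    exact x.2
  · by_contra hxp
    have hpU : (⟨⟨p, hp⟩, hpd⟩ : DiffSpec Δ R) ∈ U ⟨x, hx⟩ := hxp
    have := ht (Set.mem_iUnion.2 ⟨_, hpU⟩)
    obtain ⟨z, hz, hzp⟩ := Set.mem_iUnion₂.1 this
    exact hzp (hG _ (Finset.mem_image_of_mem _ hz))

end DiffIdeal

/-! ### The basis theorem -/

/-- The **Ritt–Raudenbush basis theorem** over a differential ring with noetherian differential
spectrum. -/
theorem RankedGenerators.hasFiniteBasis {Δ A B ι : Type*} [CommRing A] [CommRing B] [DiffRing Δ A]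
    [DiffRing Δ B] [Algebra A B] [IsDiffAlgebra Δ A B] [Algebra ℚ B] [LinearOrder ι]
    [WellFoundedLT ι] (Y : RankedGenerators Δ A B ι) (hA : ∀ I : Ideal A, HasFiniteBasis Δ I)
    (I : Ideal B) : HasFiniteBasis Δ I := by
  classical
  by_contra hI
  have hex : ∃ q : Ideal B, q.IsPrime ∧ IsDiffIdeal Δ q ∧ ¬ HasFiniteBasis Δ q ∧
      ∀ b ∉ q, HasFiniteBasis Δ (q ⊔ Ideal.span {b}) := by
    refine exists_isPrime_isDiffIdeal_not (HasFiniteBasis Δ) ?_ ?_ ?_ ?_ hI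
    · rintro c hne hc h
      obtain ⟨J, hJ, G, hGJ, hp⟩ := h.exists_mem_of_isChain hne hc
      exact ⟨J, hJ, G, hGJ, fun p hpp hpd hGp => (le_sSup hJ).trans (hp p hpp hpd hGp)⟩
    · exact ⟨{1}, by simp, fun p hp _ h => (hp.one_notMem (by simpa using h)).elim⟩
    · intro I a b hab ha hb
      obtain ⟨G, hG, hGp⟩ := ha.of_sup_span
      obtain ⟨H, hH, hHp⟩ := hb.of_sup_span
      refine ⟨insert (a * b) (G ∪ H), ?_, fun p hp hpd hp' => ?_⟩
      · simp only [Finset.mem_insert, Finset.mem_union]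
        rintro g (rfl | hg | hg)
        exacts [hab, hG g hg, hH g hg]
      · simp only [Finset.mem_insert, Finset.mem_union] at hp'
        rcases hp.mem_or_mem (hp' _ (Or.inl rfl)) with h | h
        · exact hGp p hp hpd (fun g hg => hp' g (Or.inr (Or.inl hg))) h
        · exact hHp p hp hpd (fun g hg => hp' g (Or.inr (Or.inr hg))) h
    · intro I d x hx h
      obtain ⟨G, hG, hGp⟩ := h.of_sup_span
      refine ⟨insert x G, ?_, fun p hp hpd hp' => ?_⟩
      · simp only [Finset.mem_insert]
        rintro g (rfl | hg)
        exacts [hx, hG g hg]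
      · simp only [Finset.mem_insert] at hp'
        exact hGp p hp hpd (fun g hg => hp' g (Or.inr hg)) (hpd d x (hp' _ (Or.inl rfl)))
  obtain ⟨q, hq, hqd, hqn, hqb⟩ := hex
  obtain ⟨G, hGq, s, hs, hG⟩ := Y.exists_finset_le hq hqd
  obtain ⟨H, hHq, hH⟩ := (hqb s hs).of_sup_span
  obtain ⟨E, hE, hE'⟩ := hA (q.comap (algebraMap A B))
  refine hqn ⟨G ∪ H ∪ E.image (algebraMap A B), fun g hg => ?_, fun p hp hpd hGp => ?_⟩
  · simp only [Finset.mem_union, Finset.mem_image] at hg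
    rcases hg with (hg | hg) | ⟨e, he, rfl⟩
    · exact hGq g hg
    · exact hHq g hg
    · exact hE e he
  · simp only [Finset.mem_union, Finset.mem_image] at hGp
    by_cases hsp : s ∈ p
    · exact hH p hp hpd (fun g hg => hGp g (Or.inl (Or.inr hg))) hsp
    · have hpA : q.comap (algebraMap A B) ≤ p.comap (algebraMap A B) := by
        refine hE' _ (hp.comap _) (fun d x hx => ?_) fun e he => hGp _ (Or.inr ⟨e, he, rfl⟩)
        rw [Ideal.mem_comap, ← IsDiffAlgebra.der_algebraMap]
        exact hpd d _ hx
      -- The intersection with `q` meets the condition `J ≤ q`, and it is saturated because both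
      -- primes avoid `s`.
      refine (hG (p ⊓ q) (fun d x hx => ⟨hpd d x hx.1, hqd d x hx.2⟩) inf_le_right
        (fun g hg => ⟨hGp g (Or.inl (Or.inl hg)), hGq g hg⟩) (fun a ha => ⟨hpA ha, ha⟩) ?_).trans
        inf_le_left
      exact fun x hx => ⟨(hp.mem_or_mem hx.1).resolve_left hsp,
        (hq.mem_or_mem hx.2).resolve_left hs⟩

/-! ### Leaders in the residue field and lifting of differential primes -/

theorem Subalgebra.isAlgebraic_of_forall_mem {R R' K : Type*} [CommRing R] [CommRing R']
    [CommRing K] [Algebra R K] [Algebra R' K] {E : Subalgebra R K} {D : Subalgebra R' K}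
    (h : ∀ z ∈ E, z ∈ D) {z : K} (hz : IsAlgebraic E z) : IsAlgebraic D z := by
  let i : E →+* D := E.val.toRingHom.codRestrict D fun z => h z z.2
  have hi : Function.Injective i := fun a b hab =>
    Subtype.ext (congrArg (Subtype.val : D → K) hab)
  let := i.toAlgebra
  have : IsScalarTower E D K := .of_algebraMap_eq fun _ => rfl
  exact hz.extendScalars hi

namespace RankedGenerators

variable {Δ A B ι : Type*} [CommRing A] [CommRing B] [DiffRing Δ B] [Algebra A B] [LinearOrder ι]
  (Y : RankedGenerators Δ A B ι)

theorem isLeader_iff_isAlgebraic {K : Type*} [CommRing K] [Algebra A K] (π : B →ₐ[A] K)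
    {q : Ideal B} (hπ : ∀ x, π x = 0 ↔ x ∈ q) (v : ι) :
    Y.IsLeader q v ↔ IsAlgebraic ((Y.lower v).map π) (π (Y.gen v)) := by
  let ψ : Y.lower v →+* (Y.lower v).map π := (π.subalgebraMap (Y.lower v)).toRingHom
  have hψ : Function.Surjective ψ := π.subalgebraMap_surjective (Y.lower v)
  have hψ0 : ∀ x, ψ x = 0 ↔ (x : B) ∈ q := fun x => by
    rw [← hπ]
    exact Subtype.ext_iff
  have hev : ∀ F : (Y.lower v)[X],
      aeval (π (Y.gen v)) (F.map ψ) = π (aeval (Y.gen v) F) := by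
    intro F
    rw [aeval_def, aeval_def, eval₂_map]
    exact (hom_eval₂ F _ (π : B →+* K) _).symm
  constructor
  · rintro ⟨F, hF, hl⟩
    refine ⟨F.map ψ, fun h => hl ?_, ?_⟩
    · rw [← hψ0, leadingCoeff, ← coeff_map, h, coeff_zero]
    · rw [hev, hπ]
      exact hF
  · rintro ⟨f, hf0, hf⟩
    obtain ⟨F, rfl, hdeg⟩ := exists_natDegree_eq_of_mem_lifts (mem_lifts_of_surjective hψ f)
    refine ⟨F, (hπ _).1 ((hev F).symm.trans hf), fun h => hf0 ?_⟩
    rw [← hψ0, leadingCoeff, ← coeff_map, hdeg] at h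
    exact leadingCoeff_eq_zero.1 h

theorem map_mem_subring {K : Type*} [CommRing K] [Algebra A K] (π : B →ₐ[A] K) (U : Subring K)
    (hA : ∀ a, algebraMap A K a ∈ U) {T : Set ι} (hT : ∀ w ∈ T, π (Y.gen w) ∈ U) {y : B}
    (hy : y ∈ Algebra.adjoin A (Y.gen '' T)) : π y ∈ U := by
  induction hy using Algebra.adjoin_induction with
  | mem x hx =>
    obtain ⟨w, hw, rfl⟩ := hx
    exact hT w hw
  | algebraMap a =>
    rw [AlgHom.commutes]
    exact hA a
  | add x z _ _ hx hz =>
    rw [map_add]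
    exact add_mem hx hz
  | mul x z _ _ hx hz =>
    rw [map_mul]
    exact mul_mem hx hz

/-- The generators that are not leaders are algebraically independent modulo `q`. -/
theorem algebraicIndependent_of_not_isLeader {K : Type*} [CommRing K] [IsDomain K] [Algebra A K]
    (π : B →ₐ[A] K) {q : Ideal B} (hπ : ∀ x, π x = 0 ↔ x ∈ q) :
    AlgebraicIndependent (⊥ : Subalgebra A K)
      fun v : {v // ¬ Y.IsLeader q v} => π (Y.gen v.1) := by
  classical
  refine algebraicIndependent_of_finite_type fun t ht => ?_
  obtain ⟨t, rfl⟩ := ht.exists_finset_coe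
  clear ht
  change AlgebraicIndepOn _ (fun v : {v // ¬ Y.IsLeader q v} => π (Y.gen v.1)) (t : Set _)
  -- Adding the highest index last makes the earlier ones lower, and a non-leader is transcendental
  -- over everything lower.
  induction t using Finset.induction_on_max with
  | empty =>
    rw [Finset.coe_empty]
    exact algebraicIndependent_empty_type_iff.2 Subtype.val_injective
  | insert v t hlt ih =>
    rw [Finset.coe_insert]
    refine ih.insert fun h => v.2 ((Y.isLeader_iff_isAlgebraic π hπ v.1).2 ?_)
    refine Subalgebra.isAlgebraic_of_forall_mem (fun z hz => ?_) h
    induction hz using Algebra.adjoin_induction with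
    | mem x hx =>
      obtain ⟨w, hw, rfl⟩ := hx
      exact ⟨_, Y.gen_mem_lower (hlt w hw), rfl⟩
    | algebraMap r =>
      obtain ⟨a, ha⟩ := Algebra.mem_bot.1 r.2
      have : algebraMap (⊥ : Subalgebra A K) K r = algebraMap A K a := ha.symm
      rw [this]
      exact Subalgebra.algebraMap_mem _ a
    | add x z _ _ hx hz => exact add_mem hx hz
    | mul x z _ _ hx hz => exact mul_mem hx hz

/-- All generators are algebraic over those that are not leaders, modulo `q`. -/
theorem isAlgebraic_adjoin_not_isLeader [WellFoundedLT ι] {K : Type*} [CommRing K] [IsDomain K]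
    [Algebra A K] (π : B →ₐ[A] K) {q : Ideal B} (hπ : ∀ x, π x = 0 ↔ x ∈ q) (y : B) :
    IsAlgebraic (Algebra.adjoin (⊥ : Subalgebra A K)
      (Set.range fun v : {v // ¬ Y.IsLeader q v} => π (Y.gen v.1))) (π y) := by
  set R' := Algebra.adjoin (⊥ : Subalgebra A K)
    (Set.range fun v : {v // ¬ Y.IsLeader q v} => π (Y.gen v.1))
  let U := Subalgebra.algebraicClosure R' K
  have hA : ∀ a, algebraMap A K a ∈ U.toSubring := fun a =>
    U.algebraMap_mem (algebraMap (⊥ : Subalgebra A K) R' (algebraMap A (⊥ : Subalgebra A K) a))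
  have key : ∀ v, π (Y.gen v) ∈ U.toSubring := by
    intro v
    induction v using WellFoundedLT.induction with
    | ind v ih =>
      by_cases hv : Y.IsLeader q v
      · have h1 := (Y.isLeader_iff_isAlgebraic π hπ v).1 hv
        have h2 : IsAlgebraic U (π (Y.gen v)) := by
          refine Subalgebra.isAlgebraic_of_forall_mem (fun z hz => ?_) h1
          obtain ⟨y, hy, rfl⟩ := hz
          exact Y.map_mem_subring π U.toSubring hA ih hy
        exact h2.restrictScalars R'
      · exact U.algebraMap_mem (⟨_, Algebra.subset_adjoin ⟨⟨v, hv⟩, rfl⟩⟩ : R')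
  refine Y.map_mem_subring π U.toSubring hA (T := Set.univ) (fun w _ => key w) ?_
  rw [Set.image_univ, Y.adjoin_range]
  trivial

variable [DiffRing Δ A] [IsDiffAlgebra Δ A B]

/-- `E` consists of the basic leaders and the inverses of `b` and of the denominators; every other
leader is recovered by induction on rank. -/
theorem exists_finset_forall_mem_adjoin (Y : RankedGenerators Δ A B ι) [WellFoundedLT ι]
    [Algebra ℚ B] {K : Type*} [Field K] [Algebra A K] (π : B →ₐ[A] K) {q : Ideal B}
    (hqd : IsDiffIdeal Δ q) (hπ : ∀ x, π x = 0 ↔ x ∈ q) (b : B) :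
    ∃ E : Finset K, (∀ z ∈ E, IsAlgebraic (Algebra.adjoin (⊥ : Subalgebra A K)
        (Set.range fun v : {v // ¬ Y.IsLeader q v} => π (Y.gen v.1))) z) ∧
      (π b)⁻¹ ∈ E ∧ ∀ y, π y ∈ Algebra.adjoin (Algebra.adjoin (⊥ : Subalgebra A K)
        (Set.range fun v : {v // ¬ Y.IsLeader q v} => π (Y.gen v.1))) (E : Set K) := by
  classical
  obtain ⟨G, H, M, hGq, hHq, hrel⟩ := Y.exists_finset_relations hqd
  set R' := Algebra.adjoin (⊥ : Subalgebra A K)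
    (Set.range fun v : {v // ¬ Y.IsLeader q v} => π (Y.gen v.1))
  have halg : ∀ y, IsAlgebraic R' (π y) := Y.isAlgebraic_adjoin_not_isLeader π hπ
  refine ⟨M.image (fun v => π (Y.gen v)) ∪ (insert b H).image fun h => (π h)⁻¹, fun z hz => ?_,
    Finset.mem_union_right _ (Finset.mem_image.2 ⟨b, Finset.mem_insert_self _ _, rfl⟩), ?_⟩
  · rcases Finset.mem_union.1 hz with hz | hz
    all_goals obtain ⟨w, -, rfl⟩ := Finset.mem_image.1 hz
    · exact halg _
    · exact (halg _).inv
  set E : Finset K := M.image (fun v => π (Y.gen v)) ∪ (insert b H).image fun h => (π h)⁻¹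
  let S := Algebra.adjoin R' (E : Set K)
  have hES : ∀ z ∈ E, z ∈ S := fun z hz => Algebra.subset_adjoin hz
  have hA : ∀ a, algebraMap A K a ∈ S.toSubring := fun a =>
    S.algebraMap_mem (algebraMap (⊥ : Subalgebra A K) R' (algebraMap A (⊥ : Subalgebra A K) a))
  have hgen : ∀ v, π (Y.gen v) ∈ S.toSubring := by
    intro v
    induction v using WellFoundedLT.induction with
    | ind v ih =>
      by_cases hv : Y.IsLeader q v
      · obtain ⟨hvM | ⟨s, hs, -, g, hg, hsg⟩, -⟩ := hrel q hqd hGq v hv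
        · exact hES _ (Finset.mem_union_left _ (Finset.mem_image.2 ⟨v, hvM, rfl⟩))
        · have hs0 : π s ≠ 0 := fun h => hHq s hs ((hπ s).1 h)
          have hgS : π g ∈ S := Y.map_mem_subring π S.toSubring hA ih hg
          have hsS : (π s)⁻¹ ∈ S := hES _ (Finset.mem_union_right _
            (Finset.mem_image.2 ⟨s, Finset.mem_insert_of_mem hs, rfl⟩))
          have heq : π (Y.gen v) = (π s)⁻¹ * π g := by
            rw [← hπ, map_sub, map_mul, sub_eq_zero] at hsg
            rw [← hsg, inv_mul_cancel_left₀ hs0]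
          rw [heq]
          exact S.mul_mem hsS hgS
      · exact S.algebraMap_mem (⟨_, Algebra.subset_adjoin ⟨⟨v, hv⟩, rfl⟩⟩ : R')
  intro y
  refine Y.map_mem_subring π S.toSubring hA (T := Set.univ) (fun w _ => hgen w) ?_
  rw [Set.image_univ, Y.adjoin_range]
  trivial

/-- Primes of `A` over which `S` has primes lift to primes of `B`. -/
theorem _root_.AlgHom.exists_prime_comap_eq {A B K S : Type*} [CommRing A] [CommRing B] [Field K]
    [Algebra A B] [Algebra A K] (π : B →ₐ[A] K) [CommRing S]
    (φ : (⊥ : Subalgebra A K) →+* S) (σ : S →+* K) (hσ : Function.Injective σ)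
    (hσA : ∀ z : (⊥ : Subalgebra A K), σ (φ z) = z) (hπσ : ∀ y, π y ∈ σ.range)
    {b : B} (hb : π b ≠ 0) (hbσ : (π b)⁻¹ ∈ σ.range)
    (hS : ∃ g : (⊥ : Subalgebra A K), g ≠ 0 ∧ ∀ p : Ideal (⊥ : Subalgebra A K), p.IsPrime → g ∉ p →
      ∃ n : Ideal S, n.IsPrime ∧ n.comap φ = p) :
    ∃ a : A, algebraMap A K a ≠ 0 ∧ ∀ p : Ideal A, p.IsPrime →
      RingHom.ker (algebraMap A K) ≤ p → a ∉ p → ∃ n : Ideal B, n.IsPrime ∧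
        RingHom.ker π ≤ n ∧ b ∉ n ∧ n.comap (algebraMap A B) = p := by
  obtain ⟨g, hg0, hg⟩ := hS
  let ρ : A →+* (⊥ : Subalgebra A K) := algebraMap A (⊥ : Subalgebra A K)
  have hρ : Function.Surjective ρ := fun z => by
    obtain ⟨a, ha⟩ := Algebra.mem_bot.1 z.2
    exact ⟨a, Subtype.ext ha⟩
  have hρ0 : ∀ a, ρ a = 0 ↔ algebraMap A K a = 0 := fun a => Subtype.ext_iff
  choose τ' hτ' using hπσ
  let τ : B →+* S :=
    { toFun := τ'
      map_one' := hσ (by rw [hτ', map_one, map_one])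
      map_mul' := fun x y => hσ (by rw [map_mul, hτ', hτ', hτ', map_mul])
      map_zero' := hσ (by rw [hτ', map_zero, map_zero])
      map_add' := fun x y => hσ (by rw [map_add, hτ', hτ', hτ', map_add]) }
  have hτ : ∀ y, σ (τ y) = π y := hτ'
  obtain ⟨a, rfl⟩ := hρ g
  refine ⟨a, fun h => hg0 ((hρ0 a).2 h), fun p hp hqp hap => ?_⟩
  have hker : RingHom.ker ρ ≤ p := fun c hc => hqp ((hρ0 c).1 hc)
  have hcomap : (p.map ρ).comap ρ = p := by
    rw [Ideal.comap_map_of_surjective' ρ hρ, sup_eq_left.2 hker]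
  obtain ⟨n, hn, hnp⟩ := hg (p.map ρ) (Ideal.map_isPrime_of_surjective hρ hker)
    fun h => hap (by rw [← hcomap]; exact h)
  refine ⟨n.comap τ, hn.comap τ, fun y hy => ?_, fun h => hn.one_notMem ?_, ?_⟩
  · have : τ y = 0 := hσ (by rw [hτ, map_zero]; exact hy)
    rw [Ideal.mem_comap, this]
    exact n.zero_mem
  · obtain ⟨c, hc⟩ := hbσ
    have h1 : c * τ b = 1 := hσ (by rw [map_mul, hτ, hc, inv_mul_cancel₀ hb, map_one])
    rw [← h1]
    exact n.mul_mem_left _ h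
  · ext c
    have h1 : τ (algebraMap A B c) = φ (ρ c) := hσ (by
      rw [hτ, hσA, AlgHom.commutes]
      rfl)
    rw [Ideal.mem_comap, Ideal.mem_comap, h1, ← Ideal.mem_comap, hnp, ← Ideal.mem_comap, hcomap]

/-- Given a prime differential ideal `q` and `b ∉ q`, the prime differential ideals in a nonempty
open subset of the closure of the contraction of `q` lift to prime differential ideals that contain
`q` and do not contain `b`. -/
theorem exists_forall_exists_comap_eq (Y : RankedGenerators Δ A B ι) [WellFoundedLT ι]
    [Algebra ℚ B] {q : Ideal B} (hq : q.IsPrime) (hqd : IsDiffIdeal Δ q) {b : B} (hb : b ∉ q) :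
    ∃ a : A, algebraMap A B a ∉ q ∧ ∀ p : Ideal A, p.IsPrime → IsDiffIdeal Δ p →
      q.comap (algebraMap A B) ≤ p → a ∉ p → ∃ q' : Ideal B, q'.IsPrime ∧ IsDiffIdeal Δ q' ∧
        q ≤ q' ∧ b ∉ q' ∧ q'.comap (algebraMap A B) = p := by
  obtain ⟨K, _, _, π, hπ⟩ : ∃ (K : Type _) (_ : Field K) (_ : Algebra A K) (π : B →ₐ[A] K),
      ∀ x, π x = 0 ↔ x ∈ q := by
    refine ⟨FractionRing (B ⧸ q), inferInstance, inferInstance,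
      (IsScalarTower.toAlgHom A (B ⧸ q) _).comp (Ideal.Quotient.mkₐ A q), fun x => ?_⟩
    rw [AlgHom.comp_apply, IsScalarTower.coe_toAlgHom', Ideal.Quotient.mkₐ_eq_mk,
      FaithfulSMul.algebraMap_eq_zero_iff, Ideal.Quotient.eq_zero_iff_mem]
  obtain ⟨E, hE, hbE, hπE⟩ := Y.exists_finset_forall_mem_adjoin π hqd hπ b
  obtain ⟨S, _, φ, ψ, hψ, hφψ, hψE, hS⟩ := (Y.algebraicIndependent_of_not_isLeader π
    hπ).exists_forall_prime_exists_prime_comap_eq E hE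
  obtain ⟨a, ha0, ha⟩ := π.exists_prime_comap_eq φ ψ hψ hφψ (fun y => hψE _ (hπE y))
    (fun h => hb ((hπ b).1 h)) (hψE _ (Algebra.subset_adjoin hbE)) hS
  have hAπ : ∀ c, algebraMap A K c = 0 ↔ algebraMap A B c ∈ q := fun c => by
    rw [← hπ, AlgHom.commutes]
  refine ⟨a, fun h => ha0 ((hAπ a).2 h), fun p hp hpd hqp hap => ?_⟩
  obtain ⟨N, hN, hqN, hbN, hNp⟩ := ha p hp (fun c hc => hqp ((hAπ c).1 hc)) hap
  -- `N` need not be differential. The largest differential ideal in it contains both `q` and the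
  -- extension of `p`, so its contraction is still `p`.
  obtain ⟨q', hq', hq'd, hq'N, hmax⟩ := hN.exists_isDiffIdeal_isPrime_le (Δ := Δ)
  refine ⟨q', hq', hq'd, hmax q hqd fun y hy => hqN ((hπ y).2 hy), fun h => hbN (hq'N h),
    le_antisymm ?_ ?_⟩
  · exact (Ideal.comap_mono hq'N).trans hNp.le
  · exact Ideal.map_le_iff_le_comap.1 (hmax _ hpd.map (Ideal.map_le_iff_le_comap.2 hNp.ge))

end RankedGenerators

/-! ### Constructible sets and the differential spectrum -/

section Constructible

variable {X : Type*} [TopologicalSpace X]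

theorem IsConstr.of_finite {κ : Type*} [Finite κ] {U V : κ → Set X} (hU : ∀ i, IsOpen (U i))
    (hV : ∀ i, IsClosed (V i)) : IsConstr (⋃ i, U i ∩ V i) := by
  let e := Finite.equivFin κ
  exact ⟨_, fun i => U (e.symm i), fun i => V (e.symm i), fun i => hU _, fun i => hV _,
    (e.symm.surjective.iUnion_comp fun i => U i ∩ V i).symm⟩

theorem IsConstr.empty : IsConstr (∅ : Set X) :=
  ⟨0, fun _ => ∅, fun _ => ∅, fun _ => isOpen_empty, fun _ => isClosed_empty, by simp⟩

theorem IsOpen.isConstr_inter {U V : Set X} (hU : IsOpen U) (hV : IsClosed V) :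
    IsConstr (U ∩ V) :=
  ⟨1, fun _ => U, fun _ => V, fun _ => hU, fun _ => hV, (Set.iUnion_const _).symm⟩

theorem IsConstr.union {E F : Set X} (hE : IsConstr E) (hF : IsConstr F) : IsConstr (E ∪ F) := by
  obtain ⟨n, U, V, hU, hV, rfl⟩ := hE
  obtain ⟨m, U', V', hU', hV', rfl⟩ := hF
  convert IsConstr.of_finite (κ := Fin n ⊕ Fin m) (U := Sum.elim U U') (V := Sum.elim V V')
    (by rintro (i | i); exacts [hU i, hU' i]) (by rintro (i | i); exacts [hV i, hV' i]) using 1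
  rw [Set.iUnion_sum]
  rfl

end Constructible

namespace DiffSpec

variable {Δ R : Type*} [CommRing R] [DiffRing Δ R]

theorem exists_forall_mem_of_isOpen {U : Set (DiffSpec Δ R)} (hU : IsOpen U) {q : DiffSpec Δ R}
    (hq : q ∈ U) : ∃ b ∉ q.1.asIdeal, ∀ p : DiffSpec Δ R, b ∉ p.1.asIdeal → p ∈ U := by
  obtain ⟨O, hO, rfl⟩ := isOpen_induced_iff.1 hU
  obtain ⟨_, ⟨b, rfl⟩, hqb, hbO⟩ :=
    PrimeSpectrum.isTopologicalBasis_basic_opens.exists_subset_of_mem_open hq hO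
  exact ⟨b, hqb, fun p hp => hbO hp⟩

theorem mem_of_isOpen_of_le {U : Set (DiffSpec Δ R)} (hU : IsOpen U) {q p : DiffSpec Δ R}
    (h : q.1.asIdeal ≤ p.1.asIdeal) (hp : p ∈ U) : q ∈ U := by
  obtain ⟨b, hb, hbU⟩ := exists_forall_mem_of_isOpen hU hp
  exact hbU q fun hbq => hb (h hbq)

variable (Δ) in
/-- The closed subset of the differential spectrum defined by an ideal. -/
def zeros (I : Ideal R) : Set (DiffSpec Δ R) := {q | I ≤ q.1.asIdeal}

theorem isOpen_setOf_notMem (a : R) : IsOpen {q : DiffSpec Δ R | a ∉ q.1.asIdeal} :=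
  (PrimeSpectrum.isOpen_basicOpen (a := a)).preimage continuous_subtype_val

theorem isClosed_zeros (I : Ideal R) : IsClosed (zeros Δ I) :=
  (PrimeSpectrum.isClosed_zeroLocus (I : Set R)).preimage continuous_subtype_val

theorem zeros_anti {I J : Ideal R} (h : I ≤ J) : zeros Δ J ⊆ zeros Δ I := fun _ hq => h.trans hq

theorem mem_zeros_sup_span {I : Ideal R} {b : R} {q : DiffSpec Δ R} :
    q ∈ zeros Δ (I ⊔ Ideal.span {b}) ↔ q ∈ zeros Δ I ∧ b ∈ q.1.asIdeal := by
  simp only [zeros, Set.mem_ofPred_eq, sup_le_iff, Ideal.span_singleton_le_iff_mem]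

end DiffSpec

/-! ### The noetherian induction -/

open DiffSpec

theorem RankedGenerators.isConstr_image {Δ A B ι : Type*} [CommRing A] [CommRing B] [DiffRing Δ A]
    [DiffRing Δ B] [Algebra A B] [IsDiffAlgebra Δ A B] [Algebra ℚ B] [LinearOrder ι]
    [WellFoundedLT ι] (Y : RankedGenerators Δ A B ι) (hB : ∀ I : Ideal B, HasFiniteBasis Δ I)
    {E : Set (DiffSpec Δ B)} (hE : IsConstr E) : IsConstr (diffSpecComap Δ A B '' E) := by
  classical
  let P : Ideal B → Prop := fun I => ∀ E : Set (DiffSpec Δ B), IsConstr E →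
    IsConstr (diffSpecComap Δ A B '' (E ∩ zeros Δ I))
  suffices h : P ⊥ by
    have := h E hE
    rwa [show zeros Δ (⊥ : Ideal B) = Set.univ from Set.eq_univ_of_forall fun q => (bot_le : ⊥ ≤ q.1.asIdeal),
      Set.inter_univ] at this
  by_contra hP
  have hex : ∃ q : Ideal B, q.IsPrime ∧ IsDiffIdeal Δ q ∧ ¬ P q ∧
      ∀ b ∉ q, P (q ⊔ Ideal.span {b}) := by
    refine exists_isPrime_isDiffIdeal_not P ?_ ?_ ?_ ?_ hP
    · intro c hne hc hPc
      obtain ⟨J, hJ, G, hGJ, hG⟩ := (hB (sSup c)).exists_mem_of_isChain hne hc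
      refine ⟨J, hJ, fun E hE => ?_⟩
      -- Finite bases make the closed sets along a chain become stationary.
      have : zeros Δ J = zeros Δ (sSup c) :=
        Set.Subset.antisymm (fun q hq => hG _ q.1.2 q.2 fun g hg => hq (hGJ g hg))
          (zeros_anti (le_sSup hJ))
      rw [this]
      exact hPc E hE
    · intro E _
      have : zeros Δ (⊤ : Ideal B) = ∅ := Set.eq_empty_of_forall_notMem fun q hq =>
        q.1.2.ne_top (top_le_iff.1 hq)
      rw [this, Set.inter_empty, Set.image_empty]
      exact IsConstr.empty
    · intro I a b hab ha hb E hE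
      have : zeros Δ I = zeros Δ (I ⊔ Ideal.span {a}) ∪ zeros Δ (I ⊔ Ideal.span {b}) := by
        ext q
        rw [Set.mem_union, mem_zeros_sup_span, mem_zeros_sup_span, ← and_or_left, iff_self_and]
        exact fun h => q.1.2.mem_or_mem (h hab)
      rw [this, Set.inter_union_distrib_left, Set.image_union]
      exact (ha E hE).union (hb E hE)
    · intro I d x hx h E hE
      have : zeros Δ I = zeros Δ (I ⊔ Ideal.span {DiffRing.der d x}) := by
        ext q
        rw [mem_zeros_sup_span, iff_self_and]
        exact fun h => q.2 d x (h hx)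
      rw [this]
      exact h E hE
  obtain ⟨q, hq, hqd, hPq, hqb⟩ := hex
  refine hPq fun E hE => ?_
  let Q : DiffSpec Δ B := ⟨⟨q, hq⟩, hqd⟩
  -- `Q` is the generic point of `V(q)`: a constructible set contains, or else misses, a
  -- neighbourhood of `Q` in `V(q)`.
  by_cases hQE : Q ∈ E
  · have hb : ∃ b ∉ q, ∀ p ∈ zeros Δ q, b ∉ p.1.asIdeal → p ∈ E := by
      obtain ⟨n, U, V, hU, hV, rfl⟩ := hE
      obtain ⟨i, hiU, hiV⟩ := Set.mem_iUnion.1 hQE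
      obtain ⟨b, hb, hbU⟩ := exists_forall_mem_of_isOpen (hU i) hiU
      refine ⟨b, hb, fun p hp hbp => Set.mem_iUnion.2 ⟨i, hbU p hbp, ?_⟩⟩
      by_contra hpV
      exact mem_of_isOpen_of_le (hV i).isOpen_compl (q := Q) hp hpV hiV
    obtain ⟨b, hb, hbE⟩ := hb
    obtain ⟨a, ha, hlift⟩ := Y.exists_forall_exists_comap_eq hq hqd hb
    have heq : diffSpecComap Δ A B '' (E ∩ zeros Δ q) =
        ({p | a ∉ p.1.asIdeal} ∩ zeros Δ (q.comap (algebraMap A B))) ∪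
          diffSpecComap Δ A B '' (E ∩ zeros Δ (q ⊔ Ideal.span {algebraMap A B a})) := by
      apply Set.Subset.antisymm
      · rintro _ ⟨p, ⟨hpE, hpq⟩, rfl⟩
        by_cases hap : algebraMap A B a ∈ p.1.asIdeal
        · exact Or.inr ⟨p, ⟨hpE, mem_zeros_sup_span.2 ⟨hpq, hap⟩⟩, rfl⟩
        · exact Or.inl ⟨hap, Ideal.comap_mono hpq⟩
      · rintro p (⟨hap, hpq⟩ | ⟨p', ⟨hpE, hpq⟩, rfl⟩)
        · obtain ⟨q', hq', hq'd, hqq', hbq', hq'p⟩ := hlift p.1.asIdeal p.1.2 p.2 hpq hap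
          exact ⟨⟨⟨q', hq'⟩, hq'd⟩, ⟨hbE _ hqq' hbq', hqq'⟩, Subtype.ext (PrimeSpectrum.ext hq'p)⟩
        · exact ⟨p', ⟨hpE, (mem_zeros_sup_span.1 hpq).1⟩, rfl⟩
    rw [heq]
    exact ((isOpen_setOf_notMem a).isConstr_inter (isClosed_zeros _)).union (hqb _ ha E hE)
  · have hb : ∃ b ∉ q, ∀ p ∈ zeros Δ q, p ∈ E → b ∈ p.1.asIdeal := by
      obtain ⟨n, U, V, hU, hV, rfl⟩ := hE
      have : ∀ i, ∃ b ∉ q, ∀ p ∈ zeros Δ q, p ∈ U i ∩ V i → b ∈ p.1.asIdeal := by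
        intro i
        by_cases hQV : Q ∈ V i
        · refine ⟨1, hq.one_notMem, fun p hp hpi => (hQE (Set.mem_iUnion.2 ⟨i, ?_, hQV⟩)).elim⟩
          exact mem_of_isOpen_of_le (hU i) hp hpi.1
        · obtain ⟨b, hb, hbV⟩ := exists_forall_mem_of_isOpen (hV i).isOpen_compl hQV
          refine ⟨b, hb, fun p _ hpi => ?_⟩
          by_contra hbp
          exact hbV p hbp hpi.2
      choose b hb hbp using this
      refine ⟨∏ i, b i, fun h => ?_, fun p hp hpE => ?_⟩
      · obtain ⟨i, -, hi⟩ := hq.prod_mem_iff.1 h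
        exact hb i hi
      · obtain ⟨i, hi⟩ := Set.mem_iUnion.1 hpE
        exact p.1.asIdeal.mem_of_dvd (Finset.dvd_prod_of_mem b (Finset.mem_univ i)) (hbp i p hp hi)
    obtain ⟨b, hb, hbE⟩ := hb
    have heq : E ∩ zeros Δ q = E ∩ zeros Δ (q ⊔ Ideal.span {b}) := by
      ext p
      simp only [Set.mem_inter_iff, mem_zeros_sup_span]
      exact ⟨fun h => ⟨h.1, h.2, hbE p h.2 h.1⟩, fun h => ⟨h.1, h.2.1⟩⟩
    rw [heq]
    exact hqb b hb E hE

theorem mainTheorem9 {Δ : Type*} [Finite Δ] {A B : Type*} [CommRing A] [CommRing B]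
    [DiffRing Δ A] [DiffRing Δ B] [Algebra ℚ A] [Algebra A B] [IsDiffAlgebra Δ A B]
    (hfg : IsDiffFG Δ A B) (hA : TopologicalSpace.NoetherianSpace (DiffSpec Δ A))
    (E : Set (DiffSpec Δ B)) (hE : IsConstr E) :
    IsConstr (diffSpecComap Δ A B '' E) := by
  let : Algebra ℚ B := ((algebraMap A B).comp (algebraMap ℚ A)).toAlgebra
  obtain ⟨ι, _, _, ⟨Y⟩⟩ := hfg.exists_rankedGenerators
  exact Y.isConstr_image (Y.hasFiniteBasis hasFiniteBasis_of_noetherianSpace) hE
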